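/- For a graph $G$ and an integer $i\ge 1$, an $i$-packing in $G$ is a set of vertices in which any two distinct vertices are at distance greater than $i$. The packing chromatic number $\chi_\rho(G)$ is the smallest integer $k$ such that there is a map $c:V(G)\to\{1,\dots,k\}$ for which $c^{-1}(i)$ is an $i$-packing for each $i\in\{1,\dots,k\}$. For a graph $G$ on the vertex set $\{0,1,\dots,m-1\}$ and $n\ge 1$, the generalized Sierpiński graph $S^n_G$ has vertex set $\{0,1,\dots,m-1\}^n$, and $u=u_1\dots u_n$, $v=v_1\dots v_n$ are adjacent if and only if there is $i\in\{1,\dots,n\}$ such that $u_j=v_j$ for all $j<i$, $\{u_i,v_i\}\in E(G)$, and $u_j=v_i$, $v_j=u_i$ for all $j>i$. Let $K_4-e$ be the complete graph on $\{0,1,2,3\}$ with the edge $e=\{0,2\}$ removed. **Theorem.** $$\chi_\rho(S^1_{K_4-e})=3,\qquad \chi_\rho(S^2_{K_4-e})=6,\qquad \chi_\rho(S^3_{K_4-e})=8,$$ and for every $n\ge 4$, $$8\le \chi_\rho(S^n_{K_4-e})\le 11.$$ -/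

import Mathlib

namespace SimpleGraph

/-- An `i`-packing in `G`: a set of vertices in which any two distinct vertices are at distance
greater than `i`. Vertices in different components are at distance `⊤`. -/
def IsPacking {V : Type*} (G : SimpleGraph V) (i : ℕ) (W : Set V) : Prop :=
  ∀ u ∈ W, ∀ v ∈ W, u ≠ v → (i : ℕ∞) < G.edist u v

/-- A `k`-packing coloring of `G`: a map to the colors `1, …, k` in which the vertices of color `i`
form an `i`-packing. -/
def IsPackingColoring {V : Type*} (G : SimpleGraph V) (k : ℕ) (c : V → ℕ) : Prop :=
  (∀ v, 1 ≤ c v ∧ c v ≤ k) ∧ ∀ i, 1 ≤ i → i ≤ k → G.IsPacking i {v | c v = i}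

/-- The packing chromatic number `χ_ρ(G)`, the least `k` such that `G` has a `k`-packing coloring
(and `⊤` if there is no such `k`, which never happens for a finite graph). -/
noncomputable def packingChromaticNumber {V : Type*} (G : SimpleGraph V) : ℕ∞ :=
  ⨅ k ∈ {k : ℕ | ∃ c : V → ℕ, G.IsPackingColoring k c}, (k : ℕ∞)

/-- The generalized Sierpiński graph `S^n_G` of dimension `n` with base graph `G`. Its vertices are
the words of length `n` over the vertices of `G`; two words are adjacent when they have the form
`w x y y … y` and `w y x x … x` for an edge `{x, y}` of `G`. -/
def sierpinski {V : Type*} (G : SimpleGraph V) (n : ℕ) : SimpleGraph (Fin n → V) where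
  Adj u v := ∃ i : Fin n, (∀ j, j < i → u j = v j) ∧ G.Adj (u i) (v i) ∧
    ∀ j, i < j → u j = v i ∧ v j = u i
  symm := ⟨by
    rintro u v ⟨i, h₁, h₂, h₃⟩
    exact ⟨i, fun j hj => (h₁ j hj).symm, h₂.symm, fun j hj => (h₃ j hj).symm⟩⟩
  loopless := ⟨by
    rintro u ⟨i, -, h₂, -⟩
    exact h₂.ne rfl⟩

end SimpleGraph

/-- The graph `K₄ - e` on the vertex set `{0, 1, 2, 3}`, with removed edge `e = {0, 2}`. -/
def K4MinusEdge : SimpleGraph (Fin 4) :=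
  (⊤ : SimpleGraph (Fin 4)).deleteEdges {s(0, 2)}

/-!
Upper bounds come from explicit colorings. For `n ≥ 4`, every copy of `S^4` in `S^n` is colored in
the same way, by a coloring with 11 colors. Two corners of `S^4` are at distance at least 11, so a
path of length at most 11 meets at most two copies of `S^4`, and it remains to compare the color
classes near the two ends of an edge between copies. Lower bounds come from an exhaustive
search for a coloring, and `S^3 ⊆ S^n` gives the bound for all `n ≥ 3`.

Both the colorings and the search are checked by computation. A set of vertices is a bit mask, and
the balls around all the vertices together form a single number, so that each step of the
computation is one operation on a large natural number.
-/

section PackingColoring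

open SimpleGraph

variable {V W : Type*} {G : SimpleGraph V} {H : SimpleGraph W}

theorem isPackingColoring_mono {k l : ℕ} {c : V → ℕ} (hkl : k ≤ l)
    (hc : G.IsPackingColoring k c) : G.IsPackingColoring l c := by
  refine ⟨fun v => ⟨(hc.1 v).1, (hc.1 v).2.trans hkl⟩, fun i hi _ => ?_⟩
  by_cases hik : i ≤ k
  · exact hc.2 i hi hik
  · intro u hu
    exact absurd ((hc.1 u).2.trans' hu.ge) hik

theorem edist_hom_le (φ : G →g H) (u v : V) : H.edist (φ u) (φ v) ≤ G.edist u v := by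
  refine le_iInf fun w => ?_
  rw [← w.length_map φ]
  exact (w.map φ).edist_le

theorem isPackingColoring_comp {k : ℕ} {c : W → ℕ} (hc : H.IsPackingColoring k c) (φ : G →g H)
    (hφ : Function.Injective φ) : G.IsPackingColoring k (c ∘ φ) :=
  ⟨fun v => hc.1 (φ v), fun i hi hik u hu v hv huv =>
    (hc.2 i hi hik (φ u) hu (φ v) hv (hφ.ne huv)).trans_le (edist_hom_le φ u v)⟩

theorem packingChromaticNumber_le {k : ℕ} {c : V → ℕ} (hc : G.IsPackingColoring k c) :
    G.packingChromaticNumber ≤ k :=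
  iInf₂_le k ⟨c, hc⟩

theorem add_one_le_packingChromaticNumber {k : ℕ} (h : ∀ c, ¬ G.IsPackingColoring k c) :
    (k + 1 : ℕ∞) ≤ G.packingChromaticNumber := by
  refine le_iInf₂ fun l ⟨c, hc⟩ => ?_
  by_contra! hl
  exact h c (isPackingColoring_mono (Nat.lt_succ_iff.mp (by exact_mod_cast hl)) hc)

theorem packingChromaticNumber_le_of_injective_hom (φ : G →g H) (hφ : Function.Injective φ) :
    G.packingChromaticNumber ≤ H.packingChromaticNumber :=
  le_iInf₂ fun _ ⟨_, hc⟩ => packingChromaticNumber_le (isPackingColoring_comp hc φ hφ)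

theorem edist_le_succ_iff {r : ℕ} {u w : V} :
    G.edist u w ≤ (r + 1 : ℕ) ↔ G.edist u w ≤ r ∨ ∃ v, G.Adj u v ∧ G.edist v w ≤ r := by
  constructor
  · intro h
    obtain ⟨p, hp⟩ := exists_walk_of_edist_ne_top (ne_top_of_le_ne_top (ENat.natCast_ne_top _) h)
    have hlen : p.length ≤ r + 1 := by exact_mod_cast hp.trans_le h
    cases p with
    | nil => exact .inl (by simp)
    | cons huv q =>
      exact .inr ⟨_, huv, q.edist_le.trans (by exact_mod_cast Nat.le_of_succ_le_succ hlen)⟩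
  · rintro (h | ⟨v, huv, h⟩)
    · exact h.trans (by exact_mod_cast r.le_succ)
    · calc G.edist u w ≤ G.edist u v + G.edist v w := SimpleGraph.edist_triangle
        _ ≤ 1 + r := add_le_add (edist_eq_one_iff_adj.mpr huv).le h
        _ = (r + 1 : ℕ) := by push_cast; ring

end PackingColoring

section Sierpinski

open SimpleGraph

variable {V : Type*} {G : SimpleGraph V} {m n : ℕ}

theorem sierpinski_adj_succ {u v : Fin (n + 1) → V} :
    (G.sierpinski (n + 1)).Adj u v ↔
      (u 0 = v 0 ∧ (G.sierpinski n).Adj (Fin.tail u) (Fin.tail v)) ∨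
        (G.Adj (u 0) (v 0) ∧ (Fin.tail u = fun _ => v 0) ∧ Fin.tail v = fun _ => u 0) := by
  simp only [sierpinski, Fin.exists_fin_succ, Fin.forall_fin_succ, Fin.succ_lt_succ_iff,
    Fin.succ_pos, Fin.not_lt_zero, funext_iff, Fin.tail, forall_and, exists_and_left, and_assoc,
    false_imp_iff, true_imp_iff, implies_true, true_and, lt_self_iff_false]
  exact or_comm

theorem monotone_packingChromaticNumber_sierpinski [Nonempty V] :
    Monotone fun n => (G.sierpinski n).packingChromaticNumber := by
  obtain ⟨x⟩ := ‹Nonempty V›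
  refine monotone_nat_of_le_succ fun n => ?_
  let prepend : G.sierpinski n →g G.sierpinski (n + 1) :=
    ⟨fun u => Fin.cons x u, fun h => sierpinski_adj_succ.mpr (.inl ⟨rfl, h⟩)⟩
  exact packingChromaticNumber_le_of_injective_hom prepend
    (Fin.cons_right_injective (α := fun _ => V) x)

/-- The words `p` and `q` are adjacent in a Sierpiński graph over `G`, and `a` is the first
position where they differ. -/
def AdjAt (G : SimpleGraph V) (p q : Fin n → V) (a : Fin n) : Prop :=
  (∀ j, j < a → p j = q j) ∧ G.Adj (p a) (q a) ∧ ∀ j, a < j → p j = q a ∧ q j = p a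

theorem AdjAt.symm {p q : Fin n → V} {a : Fin n} (h : AdjAt G p q a) : AdjAt G q p a :=
  ⟨fun j hj => (h.1 j hj).symm, h.2.1.symm, fun j hj => (h.2.2 j hj).symm⟩

theorem AdjAt.index_le {p q q' : Fin n → V} {a b : Fin n} (h : AdjAt G p q a)
    (h' : AdjAt G p q' b) (hab : q a = q' b) : b ≤ a :=
  not_lt.mp fun hlt => h'.2.1.ne ((h.2.2 b hlt).1.trans hab)

theorem AdjAt.unique {p q q' : Fin n → V} {a b : Fin n} (h : AdjAt G p q a)
    (h' : AdjAt G p q' b) (hab : q a = q' b) : a = b ∧ q = q' := by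
  obtain rfl : a = b := le_antisymm (h'.index_le h hab.symm) (h.index_le h' hab)
  refine ⟨rfl, funext fun j => ?_⟩
  rcases lt_trichotomy j a with hj | rfl | hj
  · rw [← h.1 j hj, h'.1 j hj]
  · exact hab
  · rw [(h.2.2 j hj).2, (h'.2.2 j hj).2]

/-- The first `m` letters of a word of length `m + n`; it names the copy of `S^n_G` in `S^(m+n)_G`
that contains the word. -/
def wordPrefix (u : Fin (m + n) → V) : Fin m → V := fun j => u (Fin.castAdd n j)

/-- The last `n` letters of a word of length `m + n`; it is the position of the word within its
copy of `S^n_G`. -/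
def wordSuffix (u : Fin (m + n) → V) : Fin n → V := fun j => u (Fin.natAdd m j)

theorem eq_of_wordPrefix_eq_of_wordSuffix_eq {u v : Fin (m + n) → V}
    (hpre : wordPrefix u = wordPrefix v) (hsuf : wordSuffix u = wordSuffix v) : u = v :=
  funext fun j => Fin.addCases (fun i => congrFun hpre i) (fun i => congrFun hsuf i) j

theorem adj_wordSuffix_or_adjAt_wordPrefix {u v : Fin (m + n) → V}
    (h : (G.sierpinski (m + n)).Adj u v) :
    (wordPrefix u = wordPrefix v ∧ (G.sierpinski n).Adj (wordSuffix u) (wordSuffix v)) ∨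
      ∃ a, AdjAt G (wordPrefix u) (wordPrefix v) a ∧ (wordSuffix u = fun _ => wordPrefix v a) ∧
        wordSuffix v = fun _ => wordPrefix u a := by
  obtain ⟨i, h₁, h₂, h₃⟩ := h
  induction i using Fin.addCases with
  | left a =>
    have hlt (j : Fin n) : Fin.castAdd n a < Fin.natAdd m j :=
      a.isLt.trans_le (Nat.le_add_right m j)
    exact .inr ⟨a, ⟨fun j hj => h₁ _ hj, h₂, fun j hj => h₃ _ hj⟩,
      funext fun j => (h₃ _ (hlt j)).1, funext fun j => (h₃ _ (hlt j)).2⟩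
  | right a =>
    exact .inl ⟨funext fun j => h₁ _ (j.isLt.trans_le (Nat.le_add_right m a)), a,
      fun j hj => h₁ _ ((Fin.natAdd_lt_natAdd_iff m).mpr hj), h₂,
      fun j hj => h₃ _ ((Fin.natAdd_lt_natAdd_iff m).mpr hj)⟩

/-- The words `u` and `y` lie in the same copy of `S^n_G` at distance at most `d` within that copy,
or in two copies joined by an edge, with a path of length at most `d` through that edge. -/
def IsNearInBlocks (G : SimpleGraph V) (d : ℕ) (u y : Fin (m + n) → V) : Prop :=
  (wordPrefix u = wordPrefix y ∧ (G.sierpinski n).edist (wordSuffix u) (wordSuffix y) ≤ d) ∨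
    ∃ a, AdjAt G (wordPrefix u) (wordPrefix y) a ∧
      (G.sierpinski n).edist (wordSuffix u) (fun _ => wordPrefix y a) + 1 +
        (G.sierpinski n).edist (fun _ => wordPrefix u a) (wordSuffix y) ≤ d

theorem IsNearInBlocks.of_adj_within {d : ℕ} {u v y : Fin (m + n) → V}
    (hpre : wordPrefix u = wordPrefix v)
    (hsuf : (G.sierpinski n).Adj (wordSuffix u) (wordSuffix v)) (h : IsNearInBlocks G d v y) :
    IsNearInBlocks G (d + 1) u y := by
  have hstep (z : Fin n → V) : (G.sierpinski n).edist (wordSuffix u) z ≤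
      (G.sierpinski n).edist (wordSuffix v) z + 1 := by
    rw [add_comm, ← edist_eq_one_iff_adj.mpr hsuf]
    exact SimpleGraph.edist_triangle
  rcases h with ⟨hvy, hd⟩ | ⟨a, ha, hd⟩
  · exact .inl ⟨hpre.trans hvy, (hstep _).trans (by push_cast; gcongr)⟩
  · refine .inr ⟨a, hpre ▸ ha, ?_⟩
    rw [hpre]
    grw [hstep, add_right_comm _ 1, hd]
    norm_num

/-- The walk cannot traverse a copy from one corner to another, so a second edge between copies
leads back to the first copy. -/
theorem IsNearInBlocks.of_adj_across {d : ℕ} {u v y : Fin (m + n) → V}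
    (hfar : ∀ x z : V, x ≠ z → (d : ℕ∞) < (G.sierpinski n).edist (fun _ => x) (fun _ => z))
    {b : Fin m} (hb : AdjAt G (wordPrefix u) (wordPrefix v) b)
    (hu : wordSuffix u = fun _ => wordPrefix v b) (hv : wordSuffix v = fun _ => wordPrefix u b)
    (h : IsNearInBlocks G d v y) : IsNearInBlocks G (d + 1) u y := by
  rcases h with ⟨hvy, hd⟩ | ⟨a, ha, hd⟩
  · refine .inr ⟨b, hvy ▸ hb, ?_⟩
    rw [← hvy, hu, edist_self, zero_add, add_comm, ← hv]
    push_cast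
    gcongr
  · have hcorner : wordPrefix u b = wordPrefix y a := by
      by_contra hne
      refine (hfar _ _ hne).not_ge (le_trans ?_ hd)
      rw [hv, add_assoc]
      exact le_self_add
    obtain ⟨rfl, huy⟩ := hb.symm.unique ha hcorner
    exact .inl ⟨huy, hu ▸ le_add_self.trans (hd.trans (by norm_num))⟩

theorem isNearInBlocks_of_walk {k : ℕ}
    (hfar : ∀ x z : V, x ≠ z → (k : ℕ∞) ≤ (G.sierpinski n).edist (fun _ => x) (fun _ => z))
    {u y : Fin (m + n) → V} (w : (G.sierpinski (m + n)).Walk u y) (hw : w.length ≤ k) :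
    IsNearInBlocks G w.length u y := by
  induction w with
  | nil => exact .inl ⟨rfl, by simp⟩
  | cons h w ih =>
    have hwk : w.length < k := hw
    rcases adj_wordSuffix_or_adjAt_wordPrefix h with ⟨hpre, hsuf⟩ | ⟨b, hb, hu, hv⟩
    · exact (ih hwk.le).of_adj_within hpre hsuf
    · exact (ih hwk.le).of_adj_across
        (fun x z hxz => lt_of_lt_of_le (by exact_mod_cast hwk) (hfar x z hxz)) hb hu hv

theorem isPackingColoring_comp_wordSuffix {k : ℕ} {c : (Fin n → V) → ℕ}
    (hc : (G.sierpinski n).IsPackingColoring k c)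
    (hfar : ∀ x y : V, x ≠ y → (k : ℕ∞) ≤ (G.sierpinski n).edist (fun _ => x) (fun _ => y))
    (hcross : ∀ x y : V, G.Adj x y → ∀ u v, c u = c v →
      (c u : ℕ∞) < (G.sierpinski n).edist u (fun _ => x) + 1 +
        (G.sierpinski n).edist (fun _ => y) v) :
    (G.sierpinski (m + n)).IsPackingColoring k (fun u => c (wordSuffix u)) := by
  refine ⟨fun v => hc.1 _, fun i hi hik u hu v hv huv => ?_⟩
  by_contra! hle
  obtain ⟨w, hw⟩ :=
    exists_walk_of_edist_ne_top (ne_top_of_le_ne_top (ENat.natCast_ne_top i) hle)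
  have hwi : w.length ≤ i := by exact_mod_cast hw.trans_le hle
  have hwi' : (w.length : ℕ∞) ≤ i := by exact_mod_cast hwi
  obtain ⟨hpre, hd⟩ | ⟨a, ha, hd⟩ := isNearInBlocks_of_walk hfar w (hwi.trans hik)
  · exact (hc.2 i hi hik _ hu _ hv fun hsuf =>
      huv (eq_of_wordPrefix_eq_of_wordSuffix_eq hpre hsuf)).not_ge (hd.trans hwi')
  · have hi : (i : ℕ∞) = c (wordSuffix u) := by exact_mod_cast hu.symm
    exact (hcross _ _ ha.2.1.symm _ _ (hu.trans hv.symm)).not_ge (hd.trans (hwi'.trans hi.le))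

end Sierpinski

section DistanceTables

open SimpleGraph

/-- The arcs from `source + p` to `target + p` for `p < length`, where vertices are represented by
numbers. -/
structure BlockArc where
  source : ℕ
  target : ℕ
  length : ℕ

/-- `l` lists the pairs of adjacent vertices of `G`, the vertices being numbered by `e`. -/
def EncodesAdj {V : Type*} {N : ℕ} (l : List BlockArc) (G : SimpleGraph V) (e : V ≃ Fin N) : Prop :=
  ∀ a b : ℕ, (∃ s ∈ l, ∃ p < s.length, a = s.source + p ∧ b = s.target + p) ↔
    ∃ u v, G.Adj u v ∧ a = e u ∧ b = e v

/-- The number whose binary ones are at the positions `d * i` for `i < n`. -/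
def stride (d : ℕ) : ℕ → ℕ
  | 0 => 0
  | n + 1 => stride d n ||| 2 ^ (d * n)

/-- Add to the row of `s.target + p`, for each `p < s.length`, the row of `s.source + p`. Row `a`
of a table `T` consists of the bits `D * a + b` with `b < D`. -/
def BlockArc.shift (s : BlockArc) (D T : ℕ) : ℕ :=
  ((T >>> (D * s.source)) % 2 ^ (D * s.length)) <<< (D * s.target)

/-- The table with a one at `(a, b)` when the vertices `a, b < N` are at distance at most `r` in
the graph with the arcs `l`. Its rows have length `D`. -/
def ballTable (l : List BlockArc) (N D : ℕ) : ℕ → ℕ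
  | 0 => stride (D + 1) N
  | r + 1 => l.foldr (fun s T => T ||| s.shift D (ballTable l N D r)) (ballTable l N D r)

theorem mul_add_inj {d a b q r : ℕ} (hq : q < d) (hr : r < d) :
    d * a + q = d * b + r ↔ a = b ∧ q = r := by
  refine ⟨fun h => ?_, by rintro ⟨rfl, rfl⟩; rfl⟩
  have hdiv := congrArg (· / d) h
  simp only [Nat.mul_add_div hq.pos, Nat.div_eq_of_lt hq, Nat.div_eq_of_lt hr, add_zero] at hdiv
  subst hdiv
  exact ⟨rfl, Nat.add_left_cancel h⟩

theorem testBit_stride {d n i : ℕ} : (stride d n).testBit i ↔ ∃ j < n, i = d * j := by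
  induction n with
  | zero => simp [stride]
  | succ n ih =>
    simp only [stride, Nat.testBit_or, Bool.or_eq_true, ih, Nat.testBit_two_pow, decide_eq_true_eq,
      Nat.lt_succ_iff_lt_or_eq, or_and_right, exists_or, exists_eq_left, @eq_comm _ (d * n)]

theorem testBit_blockArc_shift {s : BlockArc} {D T b q : ℕ} (hq : q < D) :
    (s.shift D T).testBit (D * b + q) ↔
      ∃ p < s.length, b = s.target + p ∧ T.testBit (D * (s.source + p) + q) := by
  have hrow (a : ℕ) : (D * a + q) / D = a := by
    rw [Nat.mul_add_div hq.pos, Nat.div_eq_of_lt hq, add_zero]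
  simp only [BlockArc.shift, Nat.testBit_shiftLeft, Nat.testBit_mod_two_pow, Nat.testBit_shiftRight,
    Bool.and_eq_true, decide_eq_true_eq, ge_iff_le]
  rw [mul_comm D s.target, ← Nat.le_div_iff_mul_le hq.pos, hrow]
  by_cases hb : s.target ≤ b
  · obtain ⟨p, rfl⟩ := exists_add_of_le hb
    have hsub : D * (s.target + p) + q - s.target * D = D * p + q := by
      rw [mul_add, mul_comm s.target, add_assoc, Nat.add_sub_cancel_left]
    rw [hsub, mul_comm D s.length, ← Nat.div_lt_iff_lt_mul hq.pos, hrow, ← add_assoc, ← mul_add]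
    simp only [hb, true_and, Nat.add_left_cancel_iff, exists_eq_left', and_left_comm]
  · simp only [hb, false_and, false_iff]
    rintro ⟨p, -, rfl, -⟩
    exact hb le_self_add

theorem testBit_foldr_or {α : Type*} {l : List α} {f : α → ℕ} {T i : ℕ} :
    (l.foldr (fun s T => T ||| f s) T).testBit i ↔ T.testBit i ∨ ∃ s ∈ l, (f s).testBit i := by
  induction l with
  | nil => simp
  | cons s l ih =>
    simp only [List.foldr_cons, Nat.testBit_or, Bool.or_eq_true, ih, List.exists_mem_cons_iff]
    rw [or_assoc, or_comm (a := ∃ _, _)]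

variable {V : Type*} {N : ℕ} {G : SimpleGraph V} {e : V ≃ Fin N} {l : List BlockArc}

theorem testBit_ballTable (hl : EncodesAdj l G e) {D : ℕ} (hD : N ≤ D) {r a q : ℕ} (hq : q < D) :
    (ballTable l N D r).testBit (D * a + q) ↔ ∃ u v, a = e u ∧ q = e v ∧ G.edist u v ≤ r := by
  induction r generalizing a with
  | zero =>
    simp only [ballTable, testBit_stride, Nat.cast_zero, nonpos_iff_eq_zero,
      SimpleGraph.edist_eq_zero_iff]
    constructor
    · rintro ⟨j, hj, h⟩
      rw [add_one_mul, mul_add_inj hq (hj.trans_le hD)] at h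
      exact ⟨e.symm ⟨j, hj⟩, _, by simp [h.1], by simp [h.2], rfl⟩
    · rintro ⟨u, _, rfl, rfl, rfl⟩
      exact ⟨e u, (e u).isLt, by ring⟩
  | succ r ih =>
    rw [ballTable, testBit_foldr_or, ih]
    simp only [testBit_blockArc_shift hq, ih, edist_le_succ_iff]
    constructor
    · rintro (⟨u, v, rfl, rfl, h⟩ | ⟨s, hs, p, hp, rfl, u, v, hu, rfl, h⟩)
      · exact ⟨u, v, rfl, rfl, .inl h⟩
      · obtain ⟨u', w, hadj, hu', hw⟩ := (hl (s.source + p) _).mp ⟨s, hs, p, hp, rfl, rfl⟩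
        obtain rfl : u = u' := e.injective (Fin.val_injective (hu.symm.trans hu'))
        exact ⟨w, v, hw, rfl, .inr ⟨u, hadj.symm, h⟩⟩
    · rintro ⟨w, v, rfl, rfl, h | ⟨u, hadj, h⟩⟩
      · exact .inl ⟨w, v, rfl, rfl, h⟩
      · obtain ⟨s, hs, p, hp, hu, hw⟩ := (hl _ _).mpr ⟨u, w, hadj.symm, rfl, rfl⟩
        exact .inr ⟨s, hs, p, hp, hw, u, v, hu.symm, rfl, h⟩

end DistanceTables

section WordCodes

open SimpleGraph

variable {m : ℕ} (G : SimpleGraph (Fin m)) [DecidableRel G.Adj]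

/-- The number with `n` digits in base `m`, all of them equal to `1`. -/
def repunit (m : ℕ) : ℕ → ℕ
  | 0 => 0
  | n + 1 => 1 + m * repunit m n

/-- The pairs of adjacent vertices of `S^n_G`, a word `u` being represented by `∑ i, u i * m ^ i`.
With this choice, the arcs that do not change the first letter are those of `S^(n-1)_G` with all
the numbers multiplied by `m`. -/
def sierpinskiArcs : ℕ → List BlockArc
  | 0 => []
  | n + 1 =>
    (sierpinskiArcs n).map (fun s => ⟨m * s.source, m * s.target, m * s.length⟩) ++
      ((List.finRange m ×ˢ List.finRange m).filter fun xy => G.Adj xy.1 xy.2).map fun xy =>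
        ⟨xy.1 + m * (xy.2 * repunit m n), xy.2 + m * (xy.1 * repunit m n), 1⟩

theorem finFunctionFinEquiv_succ {n : ℕ} (u : Fin (n + 1) → Fin m) :
    (finFunctionFinEquiv u : ℕ) = u 0 + m * finFunctionFinEquiv (Fin.tail u) := by
  simp only [finFunctionFinEquiv_apply, Fin.sum_univ_succ, Finset.mul_sum, Fin.tail]
  simp [pow_succ, mul_comm, mul_left_comm]

theorem finFunctionFinEquiv_const (n : ℕ) (x : Fin m) :
    (finFunctionFinEquiv (fun _ : Fin n => x) : ℕ) = x * repunit m n := by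
  induction n with
  | zero => simp [repunit]
  | succ n ih =>
    rw [finFunctionFinEquiv_succ, Fin.tail_def, ih, repunit]
    ring

theorem encodesAdj_sierpinskiArcs (n : ℕ) :
    EncodesAdj (sierpinskiArcs G n) (G.sierpinski n) finFunctionFinEquiv := by
  induction n with
  | zero => intro a b; simp [sierpinskiArcs, sierpinski]
  | succ n ih =>
    intro a b
    simp only [sierpinskiArcs, List.mem_append, or_and_right, exists_or, sierpinski_adj_succ]
    refine or_congr ?_ ?_
    · simp only [List.mem_map, exists_exists_and_eq_and]
      constructor
      · rintro ⟨s, hs, p, hp, rfl, rfl⟩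
        have hm : 0 < m := Nat.pos_of_mul_pos_right hp.pos
        obtain ⟨u, v, hadj, hu, hv⟩ :=
          (ih _ _).mp ⟨s, hs, p / m, Nat.div_lt_of_lt_mul hp, rfl, rfl⟩
        let x : Fin m := ⟨p % m, Nat.mod_lt p hm⟩
        refine ⟨Fin.cons x u, Fin.cons x v, ⟨rfl, hadj⟩, ?_, ?_⟩ <;>
          rw [finFunctionFinEquiv_succ, Fin.tail_cons, Fin.cons_zero]
        · rw [← hu, mul_add, add_left_comm, Nat.mod_add_div]
        · rw [← hv, mul_add, add_left_comm, Nat.mod_add_div]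
      · rintro ⟨u, v, ⟨hhead, hadj⟩, rfl, rfl⟩
        obtain ⟨s, hs, p, hp, hu, hv⟩ := (ih _ _).mpr ⟨_, _, hadj, rfl, rfl⟩
        refine ⟨s, hs, m * p + u 0, ?_, ?_, ?_⟩
        · calc m * p + u 0 < m * (p + 1) := by rw [mul_add_one]; gcongr; exact (u 0).isLt
            _ ≤ m * s.length := Nat.mul_le_mul_left m hp
        · rw [finFunctionFinEquiv_succ, hu]; ring
        · rw [finFunctionFinEquiv_succ, hv, hhead]; ring
    · simp only [List.mem_map, List.mem_filter, decide_eq_true_eq, Prod.exists]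
      constructor
      · rintro ⟨_, ⟨x, y, ⟨-, hxy⟩, rfl⟩, p, hp, rfl, rfl⟩
        obtain rfl : p = 0 := Nat.lt_one_iff.mp hp
        refine ⟨Fin.cons x fun _ => y, Fin.cons y fun _ => x, ⟨hxy, rfl, rfl⟩, ?_, ?_⟩ <;>
          simp only [finFunctionFinEquiv_succ, Fin.tail_cons, Fin.cons_zero,
            finFunctionFinEquiv_const, add_zero]
      · rintro ⟨u, v, ⟨hxy, hu, hv⟩, rfl, rfl⟩
        refine ⟨_, ⟨u 0, v 0, ⟨by simp, hxy⟩, rfl⟩, 0, Nat.one_pos, ?_, ?_⟩ <;>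
          simp only [finFunctionFinEquiv_succ, hu, hv, finFunctionFinEquiv_const, add_zero]

end WordCodes

section MaskColorings

open SimpleGraph

/-- The set of numbers `b < N` at distance at most `r` from `a` in the graph with the arcs `l`, as
a bit mask. Bits from `N` on have no meaning. -/
def ballMask (l : List BlockArc) (N r a : ℕ) : ℕ := ballTable l N N r >>> (N * a)

/-- The coloring whose color classes are the bit masks in `L`, colors starting from `1`. -/
def maskColor (L : List ℕ) (a : ℕ) : ℕ := L.findIdx (·.testBit a) + 1

/-- The masks in `L` are the color classes of a packing coloring of the graph with the vertices
`0, …, N - 1` and the arcs `l`. -/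
def IsPackingMasks (l : List BlockArc) (N : ℕ) (L : List ℕ) : Prop :=
  (∀ a < N, ∃ C ∈ L, C.testBit a) ∧
    ∀ i (hi : i < L.length), ∀ a < N, L[i].testBit a → ballMask l N (i + 1) a &&& L[i] = 2 ^ a

instance (l : List BlockArc) (N : ℕ) (L : List ℕ) : Decidable (IsPackingMasks l N L) :=
  inferInstanceAs (Decidable (_ ∧ _))

variable {V : Type*} {N : ℕ} {G : SimpleGraph V} {e : V ≃ Fin N} {l : List BlockArc} {L : List ℕ}

theorem testBit_ballMask (hl : EncodesAdj l G e) {r : ℕ} {u v : V} :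
    (ballMask l N r (e u)).testBit (e v) ↔ G.edist u v ≤ r := by
  rw [ballMask, Nat.testBit_shiftRight, testBit_ballTable hl le_rfl (e v).isLt]
  simp [Fin.val_inj]

theorem exists_testBit_maskColor (h : IsPackingMasks l N L) (a : Fin N) :
    ∃ i, ∃ hi : i < L.length, maskColor L a = i + 1 ∧ L[i].testBit a :=
  have hi := List.findIdx_lt_length.mpr (h.1 a a.isLt)
  ⟨_, hi, rfl, List.findIdx_getElem (w := hi)⟩

theorem isPackingColoring_maskColor (hl : EncodesAdj l G e) (h : IsPackingMasks l N L) :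
    G.IsPackingColoring L.length fun v => maskColor L (e v) := by
  refine ⟨fun v => ⟨Nat.succ_pos _, ?_⟩, fun i _ _ u hu v hv huv => ?_⟩
  · obtain ⟨i, hi, hv, -⟩ := exists_testBit_maskColor h (e v)
    exact hv.trans_le hi
  · obtain ⟨i, hi, hiu, hbu⟩ := exists_testBit_maskColor h (e u)
    obtain ⟨j, _, hjv, hbv⟩ := exists_testBit_maskColor h (e v)
    obtain rfl : i = j := Nat.succ_injective (hiu.symm.trans (hu.trans (hv.symm.trans hjv)))
    obtain rfl := hu.symm.trans hiu
    by_contra! hle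
    have hbit : (ballMask l N (i + 1) (e u) &&& L[i]).testBit (e v) := by
      rw [Nat.testBit_and, (testBit_ballMask hl).mpr hle, hbv, Bool.and_self]
    rw [h.2 i hi _ (e u).isLt hbu, Nat.testBit_two_pow, decide_eq_true_eq, Fin.val_inj] at hbit
    exact huv (e.injective hbit)

/-- The masks in `L` remain the color classes of a packing coloring when two copies of the graph
are joined by an edge from the vertex `a` of one copy to the vertex `b` of the other. -/
def IsCrossCompatible (l : List BlockArc) (N : ℕ) (L : List ℕ) (a b : ℕ) : Prop :=
  ∀ i (hi : i < L.length), ∀ r ≤ i,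
    ballMask l N r a &&& L[i] = 0 ∨ ballMask l N (i - r) b &&& L[i] = 0

instance (l : List BlockArc) (N : ℕ) (L : List ℕ) (a b : ℕ) :
    Decidable (IsCrossCompatible l N L a b) :=
  inferInstanceAs (Decidable (∀ _, _))

theorem maskColor_lt_edist_add_edist (hl : EncodesAdj l G e) (h : IsPackingMasks l N L) {p q : V}
    (hpq : IsCrossCompatible l N L (e p) (e q)) {u v : V}
    (huv : maskColor L (e u) = maskColor L (e v)) :
    (maskColor L (e u) : ℕ∞) < G.edist u p + 1 + G.edist q v := by
  obtain ⟨i, hi, hiu, hbu⟩ := exists_testBit_maskColor h (e u)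
  obtain ⟨j, _, hjv, hbv⟩ := exists_testBit_maskColor h (e v)
  obtain rfl : i = j := Nat.succ_injective (hiu.symm.trans (huv.trans hjv))
  have hdisjoint {w z : V} {r : ℕ} (hw : L[i].testBit (e w)) (hzw : G.edist z w ≤ r) :
      ballMask l N r (e z) &&& L[i] ≠ 0 := fun h0 => by
    have hbit := congrArg (Nat.testBit · (e w)) h0
    simp [hw, (testBit_ballMask hl).mpr hzw] at hbit
  rw [hiu, SimpleGraph.edist_comm]
  by_contra! hle
  obtain ⟨r, hr⟩ := ENat.ne_top_iff_exists.mp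
    (ne_top_of_le_ne_top (ENat.natCast_ne_top _) ((le_add_right le_self_add).trans hle))
  obtain ⟨s, hs⟩ := ENat.ne_top_iff_exists.mp
    (ne_top_of_le_ne_top (ENat.natCast_ne_top _) (le_add_self.trans hle))
  rw [← hr, ← hs] at hle
  have hrs : r + 1 + s ≤ i + 1 := by exact_mod_cast hle
  rcases hpq i hi r (by omega) with h0 | h0
  · exact hdisjoint hbu hr.ge h0
  · exact hdisjoint hbv (hs.ge.trans (by exact_mod_cast (by omega : s ≤ i - r))) h0

end MaskColorings

section SierpinskiMasks

open SimpleGraph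

variable {m n : ℕ} {G : SimpleGraph (Fin m)} [DecidableRel G.Adj] {L : List ℕ}

theorem packingChromaticNumber_sierpinski_le_of_masks
    (h : IsPackingMasks (sierpinskiArcs G n) (m ^ n) L) :
    (G.sierpinski n).packingChromaticNumber ≤ L.length :=
  packingChromaticNumber_le (isPackingColoring_maskColor (encodesAdj_sierpinskiArcs G n) h)

theorem packingChromaticNumber_sierpinski_add_le_of_masks {k : ℕ}
    (h : IsPackingMasks (sierpinskiArcs G n) (m ^ n) L)
    (hfar : ∀ x y : Fin m, x ≠ y → ∀ r < L.length,
      ¬ (ballMask (sierpinskiArcs G n) (m ^ n) r (x * repunit m n)).testBit (y * repunit m n))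
    (hcross : ∀ x y : Fin m, G.Adj x y → IsCrossCompatible (sierpinskiArcs G n) (m ^ n) L
      (x * repunit m n) (y * repunit m n)) :
    (G.sierpinski (k + n)).packingChromaticNumber ≤ L.length := by
  have hl := encodesAdj_sierpinskiArcs G n
  refine packingChromaticNumber_le
    (isPackingColoring_comp_wordSuffix (isPackingColoring_maskColor hl h) ?_ ?_)
  · intro x y hxy
    by_contra! hlt
    obtain ⟨r, hr⟩ := ENat.ne_top_iff_exists.mp hlt.ne_top
    refine hfar x y hxy r (by exact_mod_cast hr.trans_lt hlt) ?_
    rw [← finFunctionFinEquiv_const, ← finFunctionFinEquiv_const, testBit_ballMask hl, ← hr]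
  · intro x y hxy u v huv
    refine maskColor_lt_edist_add_edist hl h ?_ huv
    rw [finFunctionFinEquiv_const, finFunctionFinEquiv_const]
    exact hcross x y hxy

end SierpinskiMasks

section ExhaustiveSearch

open SimpleGraph

/-- The table with a one at `(a, i, b)`, that is, at the bit `N * (k * a + i) + b`, when `i < n` and
the distinct vertices `a, b < N` of the graph with the arcs `l` are at distance at most `i + 1`, so
that they cannot both have the color `i + 1`. Here `k` is the number of colors. -/
def conflictTable (l : List BlockArc) (N k : ℕ) : ℕ → ℕ
  | 0 => 0
  | n + 1 => conflictTable l N k n |||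
      ((ballTable l N (N * k) (n + 1) ^^^ ballTable l N (N * k) 0) <<< (N * n))

-- The search uses the functions `Nat.land`, `Nat.sub`, … instead of the notation because the kernel
-- evaluates them directly, without unfolding an instance at each step.

/-- The largest power of two that divides `x`, or `0` if `x = 0`. -/
def lowestBit (x : ℕ) : ℕ := Nat.xor x (Nat.land x (Nat.sub x 1))

/-- Whether `search c` returns `true` for `c` each of the `n` lowest ones of `f`, and `f` has no
other ones. -/
def allBits (search : ℕ → Bool) : ℕ → ℕ → Bool
  | 0, f => Nat.beq f 0
  | n + 1, f =>
    Nat.beq f 0 || (search (lowestBit f) && allBits search n (Nat.land f (Nat.sub f 1)))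

/-- Continue a search after giving the color `i + 1` to a vertex that excludes this color at the
vertices of the field `i` of `B`, where `c = 2 ^ (N * i)`. -/
def branch (N k : ℕ) (search : ℕ → ℕ → Bool) (F X B c : ℕ) : Bool :=
  let R := Nat.land B (Nat.mul (Nat.sub (Nat.pow 2 N) 1) c)
  search (Nat.xor F R) (Nat.lor X (Nat.land (Nat.shiftRight X (Nat.mul 2 N))
    (Nat.mul (stride N (2 * k + 2)) (Nat.div R c))))

/-- Depth-first search for a coloring of the vertices `a < N` with `k` colors that has no conflict
in the table `T`, returning `true` if there is none.

The bit `N * i + a` of `F` says that `a` may still get the color `i + 1`. The next vertex is the one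
of the lowest one of `X`. In the case of interest, the bit `N * (2 * j + 1) + a` of `X` says that
`a` is uncolored and has at most `j` possible colors left, and the bit `N * (2 * j) + a` says in
addition that `a` has a high priority, so that the search branches at a vertex with the fewest
possible colors. The soundness of the search does not depend on `X`. -/
def refute (N k T : ℕ) : ℕ → ℕ → ℕ → Bool
  | 0, _, _ => false
  | fuel + 1, F, X =>
    -- Since `2 ^ N ≡ 1`, this is `2 ^ a` where `a` is the vertex of the lowest one of `X`.
    let b := Nat.mod (lowestBit X) (Nat.sub (Nat.pow 2 N) 1)
    !(Nat.beq b 0) && allBits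
      (branch N k (refute N k T fuel) F
        (Nat.xor X (Nat.land X (Nat.mul (stride N (2 * k + 2)) b)))
        (Nat.land F (Nat.div T (Nat.pow b (N * k)))))
      k (Nat.land (Nat.div F b) (stride N k))

/-- Whether `refute` shows that the graph with the vertices `0, …, N - 1` and the arcs `l` has no
packing coloring with `k` colors. The set `P` of vertices of high priority is a bit mask. -/
def refutePacking (l : List BlockArc) (N k P : ℕ) : Bool :=
  refute N k (conflictTable l N k k) N (2 ^ (N * k) - 1)
    ((P ||| (2 ^ N - 1) <<< N) <<< (2 * N * k))

theorem testBit_and_sub_one {j q i : ℕ} :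
    (2 ^ j * (2 * q + 1) &&& (2 ^ j * (2 * q + 1) - 1)).testBit i =
      ((2 ^ j * (2 * q + 1)).testBit i && i != j) := by
  have hpred : 2 ^ j * (2 * q + 1) - 1 = 2 ^ j * (2 * q) + (2 ^ j - 1) := by
    rw [mul_add_one, Nat.add_sub_assoc Nat.one_le_two_pow]
  rw [Nat.testBit_and, hpred, Nat.testBit_two_pow_mul_add _ (Nat.sub_lt (by simp) one_pos),
    Nat.testBit_two_pow_mul]
  rcases lt_trichotomy i j with hij | rfl | hij
  · simp [hij.not_ge]
  · simp
  · obtain ⟨d, rfl⟩ := Nat.exists_eq_add_of_lt hij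
    have hd : j + d + 1 - j = d + 1 := by omega
    simp [hij.le, hij.ne', hij.not_gt, hd, Nat.testBit_succ, Nat.mul_add_div]

theorem exists_lowestBit_eq {x : ℕ} (hx : x ≠ 0) :
    ∃ j, lowestBit x = 2 ^ j ∧ ∀ i, (x &&& (x - 1)).testBit i = (x.testBit i && i != j) := by
  obtain ⟨j, _, ⟨q, rfl⟩, rfl⟩ := Nat.exists_eq_two_pow_mul_odd hx
  refine ⟨j, Nat.eq_of_testBit_eq fun i => ?_, fun i => testBit_and_sub_one⟩
  change (_ ^^^ (_ &&& (_ - 1))).testBit i = _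
  rw [Nat.testBit_xor, testBit_and_sub_one, Nat.testBit_two_pow, Nat.testBit_two_pow_mul]
  by_cases hij : i = j
  · simp [hij]
  · simp [hij, Ne.symm hij]

theorem lowestBit_mod_two_pow_sub_one {N : ℕ} (hN : 0 < N) (x : ℕ) :
    lowestBit x % (2 ^ N - 1) = 0 ∨ ∃ a < N, lowestBit x % (2 ^ N - 1) = 2 ^ a := by
  rcases eq_or_ne x 0 with rfl | hx
  · exact .inl (Nat.zero_mod _)
  obtain ⟨j, hj, -⟩ := exists_lowestBit_eq hx
  have hone : 2 ^ N ≡ 1 [MOD 2 ^ N - 1] := Nat.ModEq.symm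
    ((Nat.modEq_iff_dvd' Nat.one_le_two_pow).mpr dvd_rfl)
  have hmod : 2 ^ j ≡ 2 ^ (j % N) [MOD 2 ^ N - 1] := by
    conv_lhs => rw [← Nat.mod_add_div j N, pow_add, pow_mul]
    simpa using (hone.pow (j / N)).mul_left (2 ^ (j % N))
  rw [hj, hmod]
  have hle : 2 ^ (j % N) ≤ 2 ^ N - 1 := Nat.le_sub_one_of_lt
    (Nat.pow_lt_pow_right one_lt_two (Nat.mod_lt j hN))
  rcases hle.eq_or_lt with heq | hlt
  · exact .inl (heq ▸ Nat.mod_self _)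
  · exact .inr ⟨j % N, Nat.mod_lt j hN, Nat.mod_eq_of_lt hlt⟩

theorem allBits_eq_false {search : ℕ → Bool} {n f j : ℕ} (hf : f.testBit j)
    (hj : search (2 ^ j) = false) : allBits search n f = false := by
  have hne {f : ℕ} (hf : f.testBit j) : f ≠ 0 := by
    rintro rfl
    simp at hf
  have hbeq {f : ℕ} (hf : f.testBit j) : Nat.beq f 0 = false :=
    Bool.eq_false_iff.mpr (mt Nat.eq_of_beq_eq_true (hne hf))
  induction n generalizing f with
  | zero => exact hbeq hf
  | succ n ih =>
    obtain ⟨i, hi, hrest⟩ := exists_lowestBit_eq (hne hf)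
    rw [allBits, hbeq hf, hi, Bool.false_or]
    rcases eq_or_ne j i with rfl | hji
    · rw [hj, Bool.false_and]
    · exact Bool.and_eq_false_iff.mpr (.inr (ih ((hrest j).trans (by simp [hf, hji]))))

theorem branch_eq_false {N k F X B i : ℕ} {search : ℕ → ℕ → Bool} {g : ℕ → ℕ}
    (hF : ∀ a < N, F.testBit (N * g a + a))
    (hB : ∀ a < N, g a = i → B.testBit (N * g a + a) = false)
    (hsearch : ∀ F X, (∀ a < N, F.testBit (N * g a + a)) → search F X = false) :
    branch N k search F X B (2 ^ (N * i)) = false := by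
  refine hsearch _ _ fun a ha => ?_
  change (F ^^^ (B &&& ((2 ^ N - 1) * 2 ^ (N * i)))).testBit _ = true
  rw [Nat.testBit_xor, hF a ha, Nat.testBit_and, Nat.testBit_mul_two_pow,
    Nat.testBit_two_pow_sub_one]
  by_contra hbit
  obtain ⟨hBa, hle, hlt⟩ : B.testBit (N * g a + a) ∧ N * i ≤ N * g a + a ∧
      N * g a + a - N * i < N := by simpa using hbit
  have hga : g a = i := ((mul_add_inj ha hlt).mp (Nat.add_sub_of_le hle).symm).1
  exact Bool.false_ne_true ((hB a ha hga).symm.trans hBa)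

theorem refute_eq_false {N k T : ℕ} {g : ℕ → ℕ} (hN : 0 < N) (hg : ∀ a < N, g a < k)
    (hT : ∀ a < N, ∀ b < N, g a = g b → T.testBit (N * (k * a + g a) + b) = false)
    {fuel F X : ℕ} (hF : ∀ a < N, F.testBit (N * g a + a)) : refute N k T fuel F X = false := by
  induction fuel generalizing F X with
  | zero => rfl
  | succ fuel ih =>
    obtain h | ⟨a, ha, h⟩ := lowestBit_mod_two_pow_sub_one hN X <;>
      change (lowestBit X).mod (Nat.sub (Nat.pow 2 N) 1) = _ at h <;> simp only [refute, h]
    · rfl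
    · refine Bool.and_eq_false_iff.mpr (.inr (allBits_eq_false (j := N * g a) ?_ ?_))
      · change ((F / 2 ^ a) &&& stride N k).testBit _ = true
        rw [Nat.testBit_and, Nat.testBit_div_two_pow, hF a ha, Bool.true_and]
        exact testBit_stride.mpr ⟨g a, hg a ha, rfl⟩
      · refine branch_eq_false hF (fun b hb hab => ?_) fun F X hF => ih hF
        change (F &&& (T / (2 ^ a) ^ (N * k))).testBit _ = false
        rw [← pow_mul, Nat.testBit_and, Nat.testBit_div_two_pow, hab]
        rw [show N * g a + b + a * (N * k) = N * (k * a + g a) + b by ring, hT a ha b hb hab.symm,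
          Bool.and_false]

variable {V : Type*} {N : ℕ} {G : SimpleGraph V} {e : V ≃ Fin N} {l : List BlockArc}

theorem exists_of_testBit_conflictTable (hl : EncodesAdj l G e) {k n b : ℕ} (hNk : 0 < N * k)
    (h : (conflictTable l N k n).testBit b) :
    ∃ i u v, b = N * (k * e u + i) + e v ∧ i < n ∧ u ≠ v ∧ G.edist u v ≤ (i + 1 : ℕ) := by
  induction n with
  | zero => simp [conflictTable] at h
  | succ n ih =>
    rw [conflictTable, Nat.testBit_or, Bool.or_eq_true] at h
    rcases h with h | h
    · obtain ⟨i, u, v, hb, hi, huv⟩ := ih h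
      exact ⟨i, u, v, hb, hi.trans n.lt_succ_self, huv⟩
    · have hball (r : ℕ) := testBit_ballTable hl
        (Nat.le_mul_of_pos_right N (Nat.pos_of_mul_pos_left hNk)) (r := r)
        (a := (b - N * n) / (N * k)) (Nat.mod_lt (b - N * n) hNk)
      rw [Nat.testBit_shiftLeft, Nat.testBit_xor, ← Nat.div_add_mod (b - N * n) (N * k),
        Bool.and_eq_true, decide_eq_true_eq] at h
      obtain ⟨hle, hxor⟩ := h
      have hdiv : N * k * ((b - N * n) / (N * k)) + (b - N * n) % (N * k) = b - N * n :=
        Nat.div_add_mod _ _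
      by_cases hzero : (ballTable l N (N * k) 0).testBit
          (N * k * ((b - N * n) / (N * k)) + (b - N * n) % (N * k))
      · obtain ⟨u, v, hu, hv, huv⟩ := (hball 0).mp hzero
        have hsucc := (hball (n + 1)).mpr ⟨u, v, hu, hv, huv.trans (by simp)⟩
        rw [hzero, hsucc] at hxor
        simp at hxor
      · obtain ⟨u, v, hu, hv, huv⟩ := (hball (n + 1)).mp (by simpa [hzero] using hxor)
        refine ⟨n, u, v, ?_, n.lt_succ_self, ?_, huv⟩
        · rw [hu, hv] at hdiv
          rw [mul_add, ← mul_assoc, add_right_comm, hdiv, Nat.sub_add_cancel hle]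
        · rintro rfl
          exact hzero ((hball 0).mpr ⟨u, u, hu, hv, by simp⟩)

theorem not_isPackingColoring_of_refutePacking (hl : EncodesAdj l G e) {k P : ℕ}
    (h : refutePacking l N k P) (c : V → ℕ) : ¬ G.IsPackingColoring k c := fun hc => by
  rcases N.eq_zero_or_pos with rfl | hN
  · exact Bool.false_ne_true h
  have hk : 1 ≤ k := (hc.1 (e.symm ⟨0, hN⟩)).elim le_trans
  let g (a : ℕ) : ℕ := if ha : a < N then c (e.symm ⟨a, ha⟩) - 1 else 0
  have hgc (v : V) : g (e v) + 1 = c v := by simp [g, Nat.sub_add_cancel (hc.1 v).1]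
  have hg (a : ℕ) (ha : a < N) : g a < k := by
    obtain ⟨v, rfl⟩ : ∃ v, (e v : ℕ) = a := ⟨e.symm ⟨a, ha⟩, by simp⟩
    exact (hgc v).trans_le (hc.1 v).2
  have hT (a : ℕ) (ha : a < N) (b : ℕ) (hb : b < N) (hab : g a = g b) :
      (conflictTable l N k k).testBit (N * (k * a + g a) + b) = false := by
    by_contra hbit
    obtain ⟨i, u, v, heq, hi, huv, hdist⟩ := exists_of_testBit_conflictTable hl
      (Nat.mul_pos hN hk) (Bool.eq_true_of_not_eq_false hbit)
    rw [mul_add_inj hb (e v).isLt, mul_add_inj (hg a ha) hi] at heq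
    obtain ⟨⟨rfl, rfl⟩, rfl⟩ := heq
    rw [hgc] at hdist
    exact (hc.2 (c u) (hc.1 u).1 (hc.1 u).2 u rfl v (by simp [← hgc, hab]) huv).not_ge hdist
  have hF (a : ℕ) (ha : a < N) : (2 ^ (N * k) - 1).testBit (N * g a + a) := by
    rw [Nat.testBit_two_pow_sub_one, decide_eq_true_eq]
    calc N * g a + a < N * (g a + 1) := by rw [mul_add_one]; gcongr
      _ ≤ N * k := Nat.mul_le_mul_left N (hg a ha)
  exact Bool.false_ne_true ((refute_eq_false hN hg hT hF).symm.trans h)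

theorem add_one_le_packingChromaticNumber_sierpinski_of_refutePacking {m n k P : ℕ}
    {G : SimpleGraph (Fin m)} [DecidableRel G.Adj]
    (h : refutePacking (sierpinskiArcs G n) (m ^ n) k P) :
    (k + 1 : ℕ∞) ≤ (G.sierpinski n).packingChromaticNumber :=
  add_one_le_packingChromaticNumber
    (not_isPackingColoring_of_refutePacking (encodesAdj_sierpinskiArcs G n) h)

end ExhaustiveSearch

section K4MinusEdge

instance : DecidableRel K4MinusEdge.Adj :=
  inferInstanceAs (DecidableRel ((⊤ : SimpleGraph (Fin 4)).deleteEdges {s(0, 2)}).Adj)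

/-- The color classes of a packing coloring of `S^4_{K₄ - e}` that extends to all higher dimensions.
It was found by local search. -/
def periodicMasks : List ℕ :=
  [0x50001001000000afaffeeffefffeff5000010000000100afaffeeffefffeff,
    0x1004262427252721000000000000000ac8dac8d1100ac8d0000011000000100,
    0x1000a4010084a501001000000100000000004262080802324040000000000000,
    0x22610008c080000400001000000010000400010008110000000000000000000,
    0x4081000420000008000000000000000001100000060200000000000000000000,
    0x90000000084000000000000000000000000007000001000000000000000,
    0x2c08000000010000000000100000000000000000000000400000000000000000,
    0x8800000000000000000000000000200000400000000010000000000000,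
    0x2021000800040000000000000000000,
    0x10000800004000000000000000000000200000000000000000000000,
    0x8000000000000000000000000000000000000000000400000000000001000000]

theorem packingChromaticNumber_sierpinski_one :
    (K4MinusEdge.sierpinski 1).packingChromaticNumber = 3 :=
  le_antisymm
    (packingChromaticNumber_sierpinski_le_of_masks (L := [0x5, 0x2, 0x8]) (by decide +kernel))
    (add_one_le_packingChromaticNumber_sierpinski_of_refutePacking (k := 2) (P := 0)
      (by decide +kernel))

theorem packingChromaticNumber_sierpinski_two :
    (K4MinusEdge.sierpinski 2).packingChromaticNumber = 6 :=
  le_antisymm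
    (packingChromaticNumber_sierpinski_le_of_masks
      (L := [0xf0f, 0xd0, 0x5000, 0x20, 0x2000, 0x8000]) (by decide +kernel))
    (add_one_le_packingChromaticNumber_sierpinski_of_refutePacking (k := 5) (P := 0)
      (by decide +kernel))

theorem packingChromaticNumber_sierpinski_three :
    (K4MinusEdge.sierpinski 3).packingChromaticNumber = 8 :=
  le_antisymm
    (packingChromaticNumber_sierpinski_le_of_masks
      (L := [0xffff0000ffff, 0x21110000ce0e0000, 0xe0e000001010000, 0x8060000010000000,
        0x80000000500000, 0x5000000000200000, 0x800000, 0x20000000]) (by decide +kernel))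
    -- The priority mask was found by local search for a small search tree.
    (add_one_le_packingChromaticNumber_sierpinski_of_refutePacking (k := 7)
      (P := 0xaaac810302800000) (by decide +kernel))

theorem packingChromaticNumber_sierpinski_add_four_le (k : ℕ) :
    (K4MinusEdge.sierpinski (k + 4)).packingChromaticNumber ≤ 11 :=
  packingChromaticNumber_sierpinski_add_le_of_masks (L := periodicMasks)
    (by decide +kernel) (by decide +kernel) (by decide +kernel)

end K4MinusEdge

theorem mainTheorem5 :
    (K4MinusEdge.sierpinski 1).packingChromaticNumber = 3 ∧
    (K4MinusEdge.sierpinski 2).packingChromaticNumber = 6 ∧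
    (K4MinusEdge.sierpinski 3).packingChromaticNumber = 8 ∧
    ∀ n : ℕ, 4 ≤ n →
      8 ≤ (K4MinusEdge.sierpinski n).packingChromaticNumber ∧
      (K4MinusEdge.sierpinski n).packingChromaticNumber ≤ 11 := by
  refine ⟨packingChromaticNumber_sierpinski_one, packingChromaticNumber_sierpinski_two,
    packingChromaticNumber_sierpinski_three, fun n hn => ⟨?_, ?_⟩⟩
  · rw [← packingChromaticNumber_sierpinski_three]
    exact monotone_packingChromaticNumber_sierpinski (by omega : 3 ≤ n)
  · obtain ⟨k, rfl⟩ := Nat.exists_eq_add_of_le' hn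
    exact packingChromaticNumber_sierpinski_add_four_le k
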